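/- Let $X$ be a finite-dimensional real normed space and let $G=(V,E)$ be a finite simple graph. A placement of $G$ is a map $p:V\to X$, and the pair $(G,p)$ is called a framework in $X$. The rigidity map is $$f_G:X^V\to\mathbb{R}^E,\qquad f_G(q)=\bigl(\|q_v-q_w\|\bigr)_{vw\in E}.$$ Frameworks $(G,p)$ and $(G,q)$ are equivalent if $f_G(p)=f_G(q)$; placements $p,q$ are congruent if $g\circ p=q$ for some isometry $g:X\to X$. Let $\mathcal{T}(p)=\{g\circ p : g\in T_I\operatorname{Isom}(X)\}\subset X^V$ be the space of trivial infinitesimal flexes, where the elements of the tangent space $T_I\operatorname{Isom}(X)$ of the Lie group $\operatorname{Isom}(X)$ of isometries of $X$ at the identity $I$ are regarded as maps $X\to X$. Let $$\partial f_G(p)=\operatorname{conv}\Bigl\{\lim_{n\to\infty}df_G(x_n) : x_n\to p,\ f_G\text{ is differentiable at each }x_n\Bigr\}$$ be the set of (Clarke) generalised derivatives of $f_G$ at $p$, taken over all sequences $(x_n)$ for which the limit exists. The framework $(G,p)$ is - strongly infinitesimally rigid if $\ker A=\mathcal{T}(p)$ for every $A\in\partial f_G(p)$; - locally rigid if there is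 $\varepsilon>0$ such that every framework $(G,q)$ equivalent to $(G,p)$ with $\|q_v-p_v\|<\varepsilon$ for all $v\in V$ has $q$ congruent to $p$; - continuously rigid if for every continuous path $\gamma:[0,1]\to X^V$ with $\gamma(0)=p$ and $f_G(\gamma(t))=f_G(p)$ for all $t\in[0,1]$, the placement $\gamma(t)$ is congruent to $p$ for every $t\in[0,1]$. **Theorem.** Every strongly infinitesimally rigid framework in $X$ is locally rigid, and every locally rigid framework in $X$ is continuously rigid. -/

import Mathlib

open Filter Topology
open scoped ContDiff

namespace FrameworkRigidity

/-- The set `∂f(x)` of (Clarke) generalised derivatives of `f` at `x`: the convex hull of all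
limits of derivatives `df(xₙ)` along sequences `xₙ → x` of points of differentiability. -/
def generalisedDerivatives {E F : Type*} [NormedAddCommGroup E] [NormedSpace ℝ E]
    [NormedAddCommGroup F] [NormedSpace ℝ F] (f : E → F) (x : E) : Set (E →L[ℝ] F) :=
  convexHull ℝ {A : E →L[ℝ] F | ∃ u : ℕ → E, Tendsto u atTop (𝓝 x) ∧
    (∀ n, DifferentiableAt ℝ f (u n)) ∧ Tendsto (fun n => fderiv ℝ f (u n)) atTop (𝓝 A)}

section Frameworks

variable {X : Type*} [NormedAddCommGroup X] [NormedSpace ℝ X] {V : Type*}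

/-- The rigidity map `f_G : X^V → ℝ^E`, `p ↦ (‖p_v - p_w‖)_{vw ∈ E}`. -/
def rigidityMap (G : SimpleGraph V) (p : V → X) : G.edgeSet → ℝ := fun e =>
  Sym2.lift ⟨fun v w => ‖p v - p w‖, fun v w => norm_sub_rev (p v) (p w)⟩ (e : Sym2 V)

/-- The frameworks `(G, p)` and `(G, q)` are equivalent: all edges have the same length. -/
def Equivalent (G : SimpleGraph V) (p q : V → X) : Prop :=
  ∀ v w, G.Adj v w → ‖p v - p w‖ = ‖q v - q w‖

/-- The placements `p` and `q` differ by an isometry of `X`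
(an isometry of a finite-dimensional normed space into itself is always bijective). -/
def Congruent (p q : V → X) : Prop :=
  ∃ g : X ≃ᵢ X, ⇑g ∘ p = q

/-- The tangent space of `Isom(X)` at the identity: the velocities at `t = 0` of smooth curves
of isometries through the identity. Isometries are affine maps, so a curve of isometries is smooth
if and only if it is smooth at each point of `X`. -/
def isomTangentSpace (X : Type*) [NormedAddCommGroup X] [NormedSpace ℝ X] : Set (X → X) :=
  {g | ∃ γ : ℝ → (X ≃ᵢ X), γ 0 = IsometryEquiv.refl X ∧
    (∀ x, ContDiff ℝ ∞ (fun t => γ t x)) ∧ ∀ x, HasDerivAt (fun t => γ t x) (g x) 0}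

/-- The space `𝒯(p)` of trivial infinitesimal flexes of a placement `p`. -/
def trivialFlexes (p : V → X) : Set (V → X) :=
  {u | ∃ g ∈ isomTangentSpace X, u = g ∘ p}

/-- Every generalised rigidity operator, that is, every generalised derivative of the rigidity map
at `p`, has kernel `𝒯(p)`. -/
def StronglyInfinitesimallyRigid [Fintype V] (G : SimpleGraph V) [Fintype G.edgeSet]
    (p : V → X) : Prop :=
  ∀ A ∈ generalisedDerivatives (rigidityMap (X := X) G) p,
    {u : V → X | A u = 0} = trivialFlexes p

/-- Every equivalent framework that is sufficiently close is congruent. -/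
def LocallyRigid (G : SimpleGraph V) (p : V → X) : Prop :=
  ∃ ε : ℝ, 0 < ε ∧ ∀ q : V → X, Equivalent G p q → (∀ v, ‖q v - p v‖ < ε) → Congruent p q

/-- A continuous flex of `(G, p)`: a continuous path of placements that starts at `p` and
preserves the edge lengths. -/
structure IsContinuousFlex (G : SimpleGraph V) (p : V → X) (γ : unitInterval → V → X) : Prop where
  continuous : Continuous γ
  start : γ 0 = p
  map_eq : ∀ t, rigidityMap G (γ t) = rigidityMap G p

/-- Every continuous flex is trivial. -/
def ContinuouslyRigid (G : SimpleGraph V) (p : V → X) : Prop :=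
  ∀ γ : unitInterval → V → X, IsContinuousFlex G p γ → ∀ t, Congruent (γ t) p

end Frameworks

end FrameworkRigidity

/-!
For the first implication, suppose that placements `q n → p` are equivalent but not congruent to
`p`. Fix a Euclidean norm on `X^V` and replace `q n` by the point `r n` of its orbit under the
isometry group that is nearest to `p`; it exists because orbits are closed
(`isClosed_setOf_congruent`). Differentiating along a curve of isometries through the identity shows
that `r n - p` is orthogonal to `g ∘ r n` for every `g` in the tangent space of the isometry group
(`inner_toEuclidean_eq_zero_of_forall_norm_le`). Minimising over the orbit of `q n`, and not over
that of `p`, makes an inner product invariant under isometries unnecessary.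

Let `h` be a limit of the normalised differences `r n - p`. As `n → ∞`, `h` is orthogonal to
`𝒯(p)`, the maps `g` being affine and hence continuous. On the other hand, the rigidity map is
Lipschitz and takes the same value at `r n` and at `p`, so some generalised derivative at `p` annihilates
`h` (`exists_mem_generalisedDerivatives_apply_eq_zero`), and `h ∈ 𝒯(p)` by hypothesis. This
contradicts `h ≠ 0`. The statement about generalised derivatives rests on their compactness and on a
mean value inequality for Lipschitz maps, `le_map_sub_of_forall_le_fderiv`.

For the second implication, the radius of local rigidity at `p` also works at every placement
congruent to `p`, so the set of times at which a continuous flex is congruent to `p` is open and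
closed in `[0, 1]`.
-/

namespace FrameworkRigidity

open MeasureTheory Set
open scoped NNReal

/-! ### Generalised derivatives of Lipschitz maps -/

/-- A convex combination of points of `s` needs at most `dim E + 1` of them, so the convex hull is
a finite union of continuous images of the compact sets `stdSimplex × sᵐ`. -/
theorem isCompact_convexHull_of_isCompact {E : Type*} [NormedAddCommGroup E] [NormedSpace ℝ E]
    [FiniteDimensional ℝ E] {s : Set E} (hs : IsCompact s) : IsCompact (convexHull ℝ s) := by
  have key : convexHull ℝ s = ⋃ m ∈ Iic (Module.finrank ℝ E + 1),
      (fun a : (Fin m → ℝ) × (Fin m → E) => ∑ i, a.1 i • a.2 i) ''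
        (stdSimplex ℝ (Fin m) ×ˢ Set.pi univ fun _ => s) := by
    apply Subset.antisymm
    · intro x hx
      obtain ⟨ι, _, z, w, hz, hai, hw, hw1, rfl⟩ := eq_pos_convex_span_of_mem_convexHull hx
      have hcard : Fintype.card ι ≤ Module.finrank ℝ E + 1 :=
        hai.card_le_finrank_succ.trans (by gcongr; exact Submodule.finrank_le _)
      let e := (Fintype.equivFin ι).symm
      simp only [mem_iUnion]
      refine ⟨Fintype.card ι, hcard, (w ∘ e, z ∘ e), ⟨⟨fun i => (hw _).le, ?_⟩, fun i _ => ?_⟩, ?_⟩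
      · rw [← hw1]; exact e.sum_comp w
      · exact hz ⟨_, rfl⟩
      · exact e.sum_comp fun i => w i • z i
    · simp only [iUnion_subset_iff]
      rintro m - _ ⟨⟨w, z⟩, ⟨⟨hw, hw1⟩, hz⟩, rfl⟩
      exact mem_convexHull_of_exists_fintype w z hw hw1 (fun i => hz i trivial) rfl
  rw [key]
  refine (finite_Iic _).isCompact_biUnion fun m _ => ?_
  exact ((isCompact_stdSimplex ℝ _).prod (isCompact_univ_pi fun _ => hs)).image (by fun_prop)

section GeneralisedDerivatives

variable {E F : Type*} [NormedAddCommGroup E] [NormedSpace ℝ E] [NormedAddCommGroup F]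
  [NormedSpace ℝ F]

theorem isCompact_generalisedDerivatives [FiniteDimensional ℝ E] [FiniteDimensional ℝ F]
    {f : E → F} {K : ℝ≥0} (hf : LipschitzWith K f) (x : E) :
    IsCompact (generalisedDerivatives f x) := by
  apply isCompact_convexHull_of_isCompact
  have key : {A : E →L[ℝ] F | ∃ u : ℕ → E, Tendsto u atTop (𝓝 x) ∧
      (∀ n, DifferentiableAt ℝ f (u n)) ∧ Tendsto (fun n => fderiv ℝ f (u n)) atTop (𝓝 A)} =
      Prod.mk x ⁻¹' closure ((fun z => (z, fderiv ℝ f z)) '' {z | DifferentiableAt ℝ f z}) := by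
    ext A
    simp only [mem_ofPred_eq, mem_preimage, mem_closure_iff_seq_limit, mem_image]
    constructor
    · rintro ⟨u, hu, hd, hA⟩
      exact ⟨fun n => (u n, fderiv ℝ f (u n)), fun n => ⟨u n, hd n, rfl⟩, hu.prodMk_nhds hA⟩
    · rintro ⟨v, hv, hlim⟩
      choose u hu huv using hv
      obtain rfl : (fun n => (u n, fderiv ℝ f (u n))) = v := funext huv
      rw [nhds_prod_eq, tendsto_prod_iff'] at hlim
      exact ⟨u, hlim.1, hu, hlim.2⟩
  have hbdd : {A : E →L[ℝ] F | ∃ u : ℕ → E, Tendsto u atTop (𝓝 x) ∧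
      (∀ n, DifferentiableAt ℝ f (u n)) ∧ Tendsto (fun n => fderiv ℝ f (u n)) atTop (𝓝 A)} ⊆
      Metric.closedBall 0 K := by
    rintro A ⟨u, -, -, hA⟩
    refine Metric.isClosed_closedBall.mem_of_tendsto hA (Eventually.of_forall fun n => ?_)
    simpa using norm_fderiv_le_of_lipschitz ℝ hf
  refine (isCompact_closedBall (0 : E →L[ℝ] F) K).of_isClosed_subset ?_ hbdd
  rw [key]
  exact isClosed_closure.preimage (by fun_prop)

/-- A mean value inequality for Lipschitz maps: by Rademacher's theorem and Fubini's theorem, almost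
every translate of the segment from `x` to `y` meets the set of points of differentiability in a set
of full length, and on such a translate the fundamental theorem of calculus applies. -/
theorem le_map_sub_of_forall_le_fderiv [FiniteDimensional ℝ E] [FiniteDimensional ℝ F]
    {f : E → F} {K : ℝ≥0} (hf : LipschitzWith K f) (φ : F →L[ℝ] ℝ) {U : Set E} (hU : IsOpen U)
    (hUc : Convex ℝ U) {x y : E} (hx : x ∈ U) (hy : y ∈ U) {c : ℝ}
    (hc : ∀ z ∈ U, DifferentiableAt ℝ f z → c ≤ φ (fderiv ℝ f z (y - x))) :
    c ≤ φ (f y - f x) := by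
  by_contra! hlt
  borelize E
  let μ : Measure E := Measure.addHaar
  let W : Set E := {w | w ∈ U ∧ w + (y - x) ∈ U ∧ φ (f (w + (y - x)) - f w) < c}
  have hfc := hf.continuous
  have hW : IsOpen W := by
    refine hU.inter (IsOpen.inter (hU.preimage (by fun_prop)) ?_)
    have hcont : Continuous fun w => φ (f (w + (y - x)) - f w) := by fun_prop
    exact isOpen_lt hcont continuous_const
  have hxW : x ∈ W := ⟨hx, by simpa using hy, by simpa using hlt⟩
  have hae : ∀ᵐ w ∂μ, ∀ᵐ t : ℝ, DifferentiableAt ℝ f (w + t • (y - x)) := by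
    have := (ae_ae_add_linearMap_mem_iff (LinearMap.toSpanSingleton ℝ E (y - x)) volume μ
      (measurableSet_of_differentiableAt ℝ f)).2 hf.ae_differentiableAt
    simpa using this
  obtain ⟨w, ⟨hwU, hwU', hwlt⟩, hw⟩ :=
    (Measure.dense_of_ae hae).exists_mem_open hW ⟨x, hxW⟩ |>.imp fun _ h => h.symm
  let ψ : ℝ → ℝ := fun t => φ (f (w + t • (y - x)))
  have hψ : LipschitzWith (‖φ‖₊ * (K * ‖y - x‖₊)) ψ := by
    refine φ.lipschitz.comp (hf.comp ?_)
    refine LipschitzWith.of_dist_le_mul fun s t => ?_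
    rw [dist_add_left, dist_eq_norm, ← sub_smul, norm_smul, mul_comm, dist_eq_norm]
    rfl
  have hac : AbsolutelyContinuousOnInterval ψ 0 1 :=
    hψ.lipschitzOnWith.absolutelyContinuousOnInterval
  have hint := hac.integral_deriv_eq_sub
  have hle : ∫ _ in (0 : ℝ)..1, c ≤ ∫ t in (0 : ℝ)..1, deriv ψ t := by
    refine intervalIntegral.integral_mono_ae_restrict zero_le_one (by simp)
      hac.intervalIntegrable_deriv ?_
    filter_upwards [ae_restrict_of_ae hw, ae_restrict_mem measurableSet_Icc] with t ht ht01
    have hline : HasDerivAt (fun t : ℝ => w + t • (y - x)) (y - x) t := by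
      simpa using ((hasDerivAt_id t).smul_const (y - x)).const_add w
    have hd : HasDerivAt ψ (φ (fderiv ℝ f (w + t • (y - x)) (y - x))) t :=
      φ.hasFDerivAt.comp_hasDerivAt t (ht.hasFDerivAt.comp_hasDerivAt t hline)
    rw [hd.deriv]
    refine hc _ ?_ ht
    have := hUc.add_smul_sub_mem hwU hwU' ht01
    simpa using this
  rw [hint] at hle
  simp only [intervalIntegral.integral_const, sub_zero, smul_eq_mul, one_mul, ψ, one_smul, zero_smul,
    add_zero, ← map_sub] at hle
  exact hwlt.not_ge hle

/-- If a Lipschitz map takes the value `f p` along a sequence approaching `p` from the direction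
`h`, then `h` lies in the kernel of some generalised derivative at `p`: otherwise a linear functional
`φ` is bounded below by a positive number on all `A h`, which makes `φ ∘ f` strictly increasing
in the direction `h` near `p`. -/
theorem exists_mem_generalisedDerivatives_apply_eq_zero [FiniteDimensional ℝ E]
    [FiniteDimensional ℝ F] {f : E → F} {K : ℝ≥0} (hf : LipschitzWith K f) {p h : E} {s : ℕ → ℝ}
    {d : ℕ → E} (hs : ∀ n, 0 < s n) (hs0 : Tendsto s atTop (𝓝 0)) (hd : Tendsto d atTop (𝓝 h))
    (hfp : ∀ n, f (p + s n • d n) = f p) :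
    ∃ A ∈ generalisedDerivatives f p, A h = 0 := by
  by_contra! hne
  let ev : (E →L[ℝ] F) →L[ℝ] F := ContinuousLinearMap.apply ℝ F h
  have hC : IsCompact (ev '' generalisedDerivatives f p) :=
    (isCompact_generalisedDerivatives hf p).image ev.continuous
  have hconv : Convex ℝ (ev '' generalisedDerivatives f p) :=
    (convex_convexHull ℝ _).linear_image ev.toLinearMap
  obtain ⟨φ, u, hu, hφ⟩ := geometric_hahn_banach_point_closed hconv hC.isClosed (x := 0) (by
    rintro ⟨A, hA, hA0⟩
    exact hne A hA hA0)
  rw [map_zero] at hu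
  -- The bound `u` on the generalised derivatives at `p` passes to the derivatives near `p`.
  have hnear : ∀ᶠ z in 𝓝 p, DifferentiableAt ℝ f z → u ≤ φ (fderiv ℝ f z h) := by
    by_contra hfreq
    obtain ⟨z, hz, hzP⟩ := exists_seq_forall_of_frequently (not_eventually.1 hfreq)
    push Not at hzP
    obtain ⟨A, -, k, hk, hA⟩ := (isCompact_closedBall (0 : E →L[ℝ] F) K).tendsto_subseq
      (x := fun n => fderiv ℝ f (z n)) fun n => by
        simpa using norm_fderiv_le_of_lipschitz ℝ hf
    have hmem : A ∈ generalisedDerivatives f p :=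
      subset_convexHull ℝ _ ⟨z ∘ k, hz.comp hk.tendsto_atTop, fun n => (hzP _).1, hA⟩
    have hlim : Tendsto (fun n => φ (ev (fderiv ℝ f (z (k n))))) atTop (𝓝 (φ (ev A))) :=
      ((φ.continuous.comp ev.continuous).tendsto A).comp hA
    have hle : φ (ev A) ≤ u := le_of_tendsto' hlim fun n => (hzP (k n)).2.le
    exact (hφ _ ⟨A, hmem, rfl⟩).not_ge hle
  obtain ⟨r, hr, hball⟩ := Metric.eventually_nhds_iff_ball.1 hnear
  have hmem : ∀ᶠ n in atTop, p + s n • h ∈ Metric.ball p r := by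
    have : Tendsto (fun n => p + s n • h) atTop (𝓝 p) := by
      simpa using (hs0.smul_const h).const_add p
    exact this (Metric.ball_mem_nhds p hr)
  have hbound : ∀ᶠ n in atTop, u ≤ ‖φ‖ * (K * ‖h - d n‖) := by
    filter_upwards [hmem] with n hn
    have hmv : s n * u ≤ φ (f (p + s n • h) - f p) := by
      refine le_map_sub_of_forall_le_fderiv hf φ Metric.isOpen_ball (convex_ball p r)
        (Metric.mem_ball_self hr) hn fun z hz hdz => ?_
      rw [add_sub_cancel_left, map_smul, map_smul, smul_eq_mul]
      exact mul_le_mul_of_nonneg_left (hball z hz hdz) (hs n).le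
    have hlip : φ (f (p + s n • h) - f p) ≤ s n * (‖φ‖ * (K * ‖h - d n‖)) := by
      rw [← hfp n]
      calc _ ≤ ‖φ‖ * ‖f (p + s n • h) - f (p + s n • d n)‖ :=
            (Real.le_norm_self _).trans (φ.le_opNorm _)
        _ ≤ ‖φ‖ * (K * ‖(p + s n • h) - (p + s n • d n)‖) := by
            gcongr; exact hf.norm_sub_le _ _
        _ = _ := by
            rw [add_sub_add_left_eq_sub, ← smul_sub, norm_smul, Real.norm_of_nonneg (hs n).le]
            ring
    exact le_of_mul_le_mul_left (hmv.trans hlip) (hs n)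
  have hlim : Tendsto (fun n => ‖φ‖ * (K * ‖h - d n‖)) atTop (𝓝 0) := by
    have : Tendsto (fun n => h - d n) atTop (𝓝 0) := by simpa using hd.const_sub h
    simpa using (this.norm.const_mul (K : ℝ)).const_mul ‖φ‖
  exact hu.not_ge (ge_of_tendsto hlim hbound)

end GeneralisedDerivatives

/-! ### Isometries of a finite-dimensional normed space -/

section Isometries

variable {X : Type*} [NormedAddCommGroup X] {V : Type*}

theorem Equivalent.isometry_comp {G : SimpleGraph V} {p q : V → X} (h : Equivalent G p q)
    (g : X ≃ᵢ X) : Equivalent G p (g ∘ q) := fun v w hvw => by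
  rw [h v w hvw, Function.comp_apply, Function.comp_apply, ← dist_eq_norm, ← dist_eq_norm,
    g.dist_eq]

theorem rigidityMap_eq_iff_equivalent {G : SimpleGraph V} {p q : V → X} :
    rigidityMap G p = rigidityMap G q ↔ Equivalent G p q := by
  constructor
  · exact fun h v w hvw => congrFun h ⟨s(v, w), hvw⟩
  · intro h
    funext ⟨e, he⟩
    induction e with
    | h v w => exact h v w he

theorem Congruent.symm {p q : V → X} (h : Congruent p q) : Congruent q p := by
  obtain ⟨g, rfl⟩ := h
  exact ⟨g.symm, by ext; simp⟩

theorem Congruent.trans {p q r : V → X} (h : Congruent p q) (h' : Congruent q r) :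
    Congruent p r := by
  obtain ⟨g, rfl⟩ := h
  obtain ⟨g', rfl⟩ := h'
  exact ⟨g.trans g', rfl⟩

theorem lipschitzWith_rigidityMap [Fintype V] (G : SimpleGraph V) [Fintype G.edgeSet] :
    LipschitzWith 2 (rigidityMap (X := X) G) := by
  refine LipschitzWith.of_dist_le_mul fun p q => (dist_pi_le_iff (by positivity)).2 ?_
  rintro ⟨e, he⟩
  induction e with
  | h v w =>
    change dist ‖p v - p w‖ ‖q v - q w‖ ≤ _
    calc dist ‖p v - p w‖ ‖q v - q w‖ ≤ dist (p v - p w) (q v - q w) := by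
          rw [Real.dist_eq, dist_eq_norm]; exact abs_norm_sub_norm_le _ _
      _ ≤ dist (p v) (q v) + dist (p w) (q w) := dist_sub_sub_le _ _ _ _
      _ ≤ dist p q + dist p q := add_le_add (dist_le_pi_dist p q v) (dist_le_pi_dist p q w)
      _ = _ := by push_cast; ring

variable [NormedSpace ℝ X]

/-- By the Mazur–Ulam theorem isometries are affine, hence so are their pointwise limits. -/
theorem continuous_of_mem_isomTangentSpace [FiniteDimensional ℝ X] {g : X → X}
    (hg : g ∈ isomTangentSpace X) : Continuous g := by
  obtain ⟨γ, -, -, hγ⟩ := hg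
  have hadd (t : ℝ) (x y : X) : γ t (x + y) = γ t x + γ t y - γ t 0 := by
    have h := (γ t).toRealAffineIsometryEquiv.map_vadd 0 y
    have h' := (γ t).toRealAffineIsometryEquiv.map_vadd x y
    simp only [IsometryEquiv.coeFn_toRealAffineIsometryEquiv, vadd_eq_add, add_zero] at h h'
    rw [add_comm x y, h', h]
    abel
  have hsmul (t c : ℝ) (x : X) : γ t (c • x) = c • (γ t x - γ t 0) + γ t 0 := by
    have h := (γ t).toRealAffineIsometryEquiv.map_vadd 0 x
    have h' := (γ t).toRealAffineIsometryEquiv.map_vadd 0 (c • x)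
    simp only [IsometryEquiv.coeFn_toRealAffineIsometryEquiv, vadd_eq_add, add_zero,
      map_smul] at h h'
    rw [h', h, add_sub_cancel_right]
  let L : X →ₗ[ℝ] X :=
    { toFun := fun x => g x - g 0
      map_add' := fun x y => by
        have h := ((hγ x).add (hγ y)).sub (hγ 0)
        have h' := (hγ (x + y)).unique (h.congr_of_eventuallyEq (.of_forall fun t => hadd t x y))
        rw [h']
        abel
      map_smul' := fun c x => by
        have h := (((hγ x).sub (hγ 0)).const_smul c).add (hγ 0)
        have h' := (hγ (c • x)).unique
          (h.congr_of_eventuallyEq (.of_forall fun t => hsmul t c x))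
        rw [h', add_sub_cancel_right]
        rfl }
  have hL : g = fun x => L x + g 0 := by
    funext x
    exact (sub_add_cancel (g x) (g 0)).symm
  rw [hL]
  exact L.continuous_of_finiteDimensional.add continuous_const

/-- The linear isometries form a compact set `S`, and for a fixed vertex `v₀` a placement `r` lies in
the orbit of `q` if and only if `r v = r v₀ + L (q v - q v₀)` for some `L ∈ S`. Thus the orbit is the
image of a closed set under a projection along `S`. -/
theorem isClosed_setOf_congruent [FiniteDimensional ℝ X] (q : V → X) :
    IsClosed {r : V → X | Congruent q r} := by
  rcases isEmpty_or_nonempty V with hV | ⟨⟨v₀⟩⟩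
  · exact (Set.subsingleton_of_subsingleton).isClosed
  let S : Set (X →L[ℝ] X) := {L | ∀ x, ‖L x‖ = ‖x‖}
  have hSc : IsClosed S := by
    simp only [S, ofPred_forall]
    exact isClosed_iInter fun x => isClosed_eq (by fun_prop) continuous_const
  have hS : IsCompact S := by
    refine (isCompact_closedBall (0 : X →L[ℝ] X) 1).of_isClosed_subset hSc fun L hL => ?_
    rw [mem_closedBall_zero_iff]
    exact L.opNorm_le_bound zero_le_one fun x => by rw [hL x, one_mul]
  have : CompactSpace S := isCompact_iff_compactSpace.1 hS
  let Z : Set (S × (V → X)) := {a | ∀ v, a.2 v = a.2 v₀ + (a.1 : X →L[ℝ] X) (q v - q v₀)}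
  have hZ : IsClosed Z := by
    simp only [Z, ofPred_forall]
    exact isClosed_iInter fun v => isClosed_eq (by fun_prop) (by fun_prop)
  convert isClosedMap_snd_of_compactSpace Z hZ using 1
  ext r
  constructor
  · rintro ⟨g, rfl⟩
    let L := g.toRealAffineIsometryEquiv.linearIsometryEquiv
    refine ⟨(⟨(L.toContinuousLinearEquiv : X →L[ℝ] X), L.norm_map⟩, g ∘ q), fun v => ?_, rfl⟩
    have h := g.toRealAffineIsometryEquiv.map_vadd (q v₀) (q v - q v₀)
    simp only [IsometryEquiv.coeFn_toRealAffineIsometryEquiv, vadd_eq_add, sub_add_cancel] at h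
    change g (q v) = g (q v₀) + L (q v - q v₀)
    rw [h, add_comm]
  · rintro ⟨⟨⟨L, hL⟩, r⟩, hr, rfl⟩
    let L' : X ≃ₗᵢ[ℝ] X := LinearIsometry.toLinearIsometryEquiv ⟨L.toLinearMap, hL⟩ rfl
    refine ⟨L'.toIsometryEquiv.trans (IsometryEquiv.addRight (r v₀ - L (q v₀))), ?_⟩
    funext v
    have h := hr v
    simp only [map_sub] at h
    change L (q v) + (r v₀ - L (q v₀)) = r v
    rw [h]
    abel

variable [Fintype V] [FiniteDimensional ℝ X]

theorem exists_congruent_forall_norm_le (p q : V → X) :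
    ∃ r, Congruent q r ∧ ∀ r', Congruent q r' →
      ‖toEuclidean (r - p)‖ ≤ ‖toEuclidean (r' - p)‖ := by
  let T : (V → X) ≃L[ℝ] _ := toEuclidean
  have hcl : IsClosed (T '' {r | Congruent q r}) :=
    T.toHomeomorph.isClosedMap _ (isClosed_setOf_congruent q)
  have hne : (T '' {r | Congruent q r}).Nonempty := ⟨_, q, ⟨IsometryEquiv.refl X, rfl⟩, rfl⟩
  obtain ⟨_, ⟨r, hr, rfl⟩, hdist⟩ := hcl.exists_infDist_eq_dist hne (T p)
  refine ⟨r, hr, fun r' hr' => ?_⟩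
  have h : dist (T p) (T r) ≤ dist (T p) (T r') :=
    hdist ▸ Metric.infDist_le_dist_of_mem ⟨r', hr', rfl⟩
  rw [dist_comm, dist_comm (T p), dist_eq_norm, dist_eq_norm, ← map_sub, ← map_sub] at h
  exact h

/-- First order condition for a placement `r` of its orbit nearest to `p`. -/
theorem inner_toEuclidean_eq_zero_of_forall_norm_le {p r : V → X}
    (hmin : ∀ r', Congruent r r' → ‖toEuclidean (r - p)‖ ≤ ‖toEuclidean (r' - p)‖)
    {g : X → X} (hg : g ∈ isomTangentSpace X) :
    inner ℝ (toEuclidean (r - p)) (toEuclidean (g ∘ r)) = 0 := by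
  obtain ⟨γ, hγ0, -, hγ⟩ := hg
  let T : (V → X) ≃L[ℝ] _ := toEuclidean
  have hd : HasDerivAt (fun t => T (γ t ∘ r - p)) (T (g ∘ r)) 0 := by
    have h : HasDerivAt (fun t => γ t ∘ r - p) (g ∘ r) 0 :=
      (hasDerivAt_pi.2 fun v => hγ (r v)).sub_const p
    exact T.toContinuousLinearMap.hasFDerivAt.comp_hasDerivAt 0 h
  have hloc : IsLocalMin (fun t => ‖T (γ t ∘ r - p)‖ ^ 2) 0 := .of_forall fun t => by
    have h0 : γ 0 ∘ r = r := by rw [hγ0]; rfl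
    simp only [h0]
    gcongr
    exact hmin _ ⟨γ t, rfl⟩
  have h := hloc.hasDerivAt_eq_zero hd.norm_sq
  have h0 : γ 0 ∘ r = r := by rw [hγ0]; rfl
  rw [h0] at h
  linarith

end Isometries

/-! ### The implications between the notions of rigidity -/

section Rigidity

variable {X : Type*} [NormedAddCommGroup X] {V : Type*} [Fintype V]

theorem StronglyInfinitesimallyRigid.locallyRigid [NormedSpace ℝ X] [FiniteDimensional ℝ X]
    {G : SimpleGraph V} [Fintype G.edgeSet] {p : V → X} (hp : StronglyInfinitesimallyRigid G p) :
    LocallyRigid G p := by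
  by_contra hnot
  simp only [LocallyRigid, not_exists, not_and, not_forall] at hnot
  choose q hpq hqp hnc using fun n : ℕ => hnot (1 / (n + 1 : ℝ)) (by positivity)
  have hq : Tendsto q atTop (𝓝 p) := by
    refine tendsto_pi_nhds.2 fun v => tendsto_iff_norm_sub_tendsto_zero.2 ?_
    exact squeeze_zero (fun n => norm_nonneg _) (fun n => (hqp n v).le)
      tendsto_one_div_add_atTop_nhds_zero_nat
  let T : (V → X) ≃L[ℝ] _ := toEuclidean
  choose r hqr hmin using fun n => exists_congruent_forall_norm_le p (q n)
  have hrmin (n : ℕ) (r') (h : Congruent (r n) r') : ‖T (r n - p)‖ ≤ ‖T (r' - p)‖ :=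
    hmin n r' ((hqr n).trans h)
  have hpr (n : ℕ) : Equivalent G p (r n) := by
    obtain ⟨g, hg⟩ := hqr n
    exact hg ▸ (hpq n).isometry_comp g
  have hrp (n : ℕ) : 0 < ‖T (r n - p)‖ := by
    refine norm_pos_iff.2 fun h => hnc n ?_
    have h' : r n = p := sub_eq_zero.1 (T.map_eq_zero_iff.1 h)
    exact (h' ▸ hqr n).symm
  have hs0 : Tendsto (fun n => ‖T (r n - p)‖) atTop (𝓝 0) := by
    have h : Tendsto (fun n => ‖T (q n - p)‖) atTop (𝓝 0) := by
      simpa using ((T.continuous.tendsto _).comp (hq.sub_const p)).norm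
    exact squeeze_zero (fun n => norm_nonneg _)
      (fun n => hmin n _ ⟨IsometryEquiv.refl X, rfl⟩) h
  have hr : Tendsto r atTop (𝓝 p) := by
    have h := (T.symm.continuous.tendsto _).comp (tendsto_zero_iff_norm_tendsto_zero.2 hs0)
    rw [map_zero] at h
    simpa [Function.comp_def] using h.add_const p
  -- On a subsequence the unit vectors in the direction of `T (r n - p)` converge.
  obtain ⟨e, he, k, hk, hke⟩ := (isCompact_sphere (0 : EuclideanSpace ℝ _) 1).tendsto_subseq
    (x := fun n => ‖T (r n - p)‖⁻¹ • T (r n - p)) fun n => by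
      rw [mem_sphere_zero_iff_norm, norm_smul, norm_inv, norm_norm,
        inv_mul_cancel₀ (hrp n).ne']
  have hd : Tendsto (fun n => T.symm (‖T (r (k n) - p)‖⁻¹ • T (r (k n) - p))) atTop
      (𝓝 (T.symm e)) := (T.symm.continuous.tendsto e).comp hke
  obtain ⟨A, hA, hA0⟩ := exists_mem_generalisedDerivatives_apply_eq_zero
    (lipschitzWith_rigidityMap G) (p := p) (s := fun n => ‖T (r (k n) - p)‖)
    (fun n => hrp _) (hs0.comp hk.tendsto_atTop) hd fun n => by
      rw [map_smul, T.symm_apply_apply, smul_inv_smul₀ (hrp _).ne', add_sub_cancel]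
      exact (rigidityMap_eq_iff_equivalent.2 (hpr _)).symm
  obtain ⟨g, hg, hge⟩ : T.symm e ∈ trivialFlexes p := by
    rw [← hp A hA]
    exact hA0
  -- The limit direction is orthogonal to the trivial flexes, and it is one of them.
  have hinner : inner ℝ e (T (g ∘ p)) = 0 := by
    have hgr : Tendsto (fun n => T (g ∘ r (k n))) atTop (𝓝 (T (g ∘ p))) := by
      refine (T.continuous.tendsto _).comp (tendsto_pi_nhds.2 fun v => ?_)
      exact ((continuous_of_mem_isomTangentSpace hg).tendsto _).comp
        ((tendsto_pi_nhds.1 hr v).comp hk.tendsto_atTop)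
    refine tendsto_nhds_unique (hke.inner hgr) (tendsto_const_nhds.congr fun n => ?_)
    have h : inner ℝ (T (r (k n) - p)) (T (g ∘ r (k n))) = 0 :=
      inner_toEuclidean_eq_zero_of_forall_norm_le (hrmin (k n)) hg
    rw [Function.comp_apply, real_inner_smul_left, h, mul_zero]
  rw [← hge, T.apply_symm_apply, inner_self_eq_zero] at hinner
  simp [hinner] at he

/-- The radius in the definition of local rigidity serves for all placements congruent to `p`, so
along a continuous flex the times at which the placement is congruent to `p` form a clopen set. -/
theorem LocallyRigid.continuouslyRigid {G : SimpleGraph V} {p : V → X} (hp : LocallyRigid G p) :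
    ContinuouslyRigid G p := by
  intro γ hγ
  obtain ⟨ε, hε, hloc⟩ := hp
  have heq (t) : Equivalent G p (γ t) := rigidityMap_eq_iff_equivalent.1 (hγ.map_eq t).symm
  have hnear (s t) (hst : dist (γ t) (γ s) < ε) (hs : Congruent (γ s) p) : Congruent (γ t) p := by
    obtain ⟨g, hg⟩ := hs
    have hgt : Congruent p (g ∘ γ t) := by
      refine hloc _ ((heq t).isometry_comp g) fun v => ?_
      rw [← hg, ← dist_eq_norm, Function.comp_apply, Function.comp_apply, g.dist_eq]
      exact (dist_le_pi_dist _ _ v).trans_lt hst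
    exact Congruent.trans ⟨g, rfl⟩ hgt.symm
  have hball (t) : ∀ᶠ s in 𝓝 t, dist (γ s) (γ t) < ε :=
    (hγ.continuous.tendsto t).eventually (Metric.ball_mem_nhds _ hε)
  have hclopen : IsClopen {t | Congruent (γ t) p} := by
    refine ⟨isClosed_iff_frequently.2 fun t ht => ?_, isOpen_iff_mem_nhds.2 fun t ht => ?_⟩
    · obtain ⟨s, hs, hst⟩ := (ht.and_eventually (hball t)).exists
      exact hnear s t (by rwa [dist_comm]) hs
    · filter_upwards [hball t] with s hs using hnear t s hs ht
  have huniv := hclopen.eq_univ ⟨0, by rw [mem_ofPred_eq, hγ.start]; exact ⟨.refl X, rfl⟩⟩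
  exact fun t => huniv.ge (mem_univ t)

end Rigidity

end FrameworkRigidity

theorem mainTheorem1 {X : Type*} [NormedAddCommGroup X] [NormedSpace ℝ X] [FiniteDimensional ℝ X]
    {V : Type*} [Fintype V] (G : SimpleGraph V) [Fintype G.edgeSet] (p : V → X) :
    (FrameworkRigidity.StronglyInfinitesimallyRigid G p → FrameworkRigidity.LocallyRigid G p) ∧
    (FrameworkRigidity.LocallyRigid G p → FrameworkRigidity.ContinuouslyRigid G p) :=
  ⟨fun h => h.locallyRigid, fun h => h.continuouslyRigid⟩
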